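/- Let $K\subseteq\mathbb{R}^n$ be non-empty, closed and convex (possibly unbounded), with diameter $d\in[0,\infty]$. One observes $Y=\mu+\xi$ with unknown $\mu\in K$ and $\xi\sim N(0,\sigma^2\mathbb{I}_n)$. Write $\mathbb{E}_\mu$ for the expectation under this law, and let $\hat\mu(Y)=\operatorname{argmin}_{\nu\in K}\|Y-\nu\|^2$ be the least squares estimator (LSE). Let $B(\theta,\varepsilon)$ be the closed Euclidean ball, and let $M(\delta,T)$ be the largest cardinality of a subset of $T$ whose distinct points are at distance $>\delta$. For a constant $c^*>0$ put $$w_\mu(\varepsilon)=\mathbb{E}\sup_{t\in B(\mu,\varepsilon)\cap K}\langle x,t\rangle,\quad x\sim N(0,\mathbb{I}_n),\qquad M^{\mathrm{loc}}(\varepsilon)=\sup_{\theta\in K}M\big(\varepsilon/c^*,B(\theta,\varepsilon)\cap K\big).$$ There is an absolute constant $c_0>0$ such that for all $c^*\ge c_0$, $c>0$ and $A>0$ there is a constant $C<\infty$, depending only on $c^*$, $c$ and $A$, with the following properties for every $n$ and every such $K$. 1. Suppose that $$\sup_{\mu\in K}\frac{w_\mu(\varepsilon)}{\varepsilon}\le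 A\sqrt{\log M^{\mathrm{loc}}(c\varepsilon)}\qquad\text{for all }0<\varepsilon\le d\ (\varepsilon<\infty).\tag{1}$$ Then the LSE is minimax optimal for all $\sigma>0$, i.e. $$\sup_{\mu\in K}\mathbb{E}_\mu\|\hat\mu(Y)-\mu\|^2\le C\,\inf_{\hat\nu}\sup_{\mu\in K}\mathbb{E}_\mu\|\hat\nu(Y)-\mu\|^2,\tag{2}$$ where the infimum is over all measurable $\hat\nu:\mathbb{R}^n\to\mathbb{R}^n$. 2. If $K$ is centrally symmetric ($K=-K$), it suffices to look around the point $0$: if $$\frac{w_0(\varepsilon)}{\varepsilon}\le A\sqrt{\log M\big(c\varepsilon/c^*,B(0,c\varepsilon)\cap K\big)}\qquad\text{for all }0<\varepsilon\le d\ (\varepsilon<\infty),\tag{3}$$ then (2) holds for all $\sigma>0$. Nothing is lost by this up to constants: for such $K$, (1) with constants $(A,c)$ implies (3) with constants $(A,c/2)$. -/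

import Mathlib

open MeasureTheory ProbabilityTheory
open scoped NNReal ENNReal

noncomputable section

namespace GaussianSequence

/-- The space `ℝⁿ` with its Euclidean norm. -/
abbrev Rn (n : ℕ) : Type := EuclideanSpace ℝ (Fin n)

variable {n : ℕ}

/-- The Gaussian width `w(T) = E sup_{t ∈ T} ⟨x, t⟩`, `x ∼ N(0, I_n)`, of a (non-empty, bounded)
set `T`. -/
def gaussianWidth (T : Set (Rn n)) : ℝ :=
  ∫ x, ⨆ t : T, inner ℝ x (t : Rn n) ∂(stdGaussian (Rn n))

/-- The local Gaussian width `w_μ(ε) = w(B(μ, ε) ∩ K)`; `B(μ, ε)` is the closed ball. -/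
def localWidth (K : Set (Rn n)) (μ : Rn n) (ε : ℝ) : ℝ :=
  gaussianWidth (Metric.closedBall μ ε ∩ K)

/-- The packing number `M(ε / c⋆, B(θ, ε) ∩ K)`: the largest cardinality of a subset of
`B(θ, ε) ∩ K` whose distinct points have distance `> ε / c⋆`. -/
def ballPacking (cs : ℝ) (K : Set (Rn n)) (θ : Rn n) (ε : ℝ) : ℕ∞ :=
  Metric.packingNumber (ε / cs).toNNReal (Metric.closedBall θ ε ∩ K)

/-- `M^loc(ε) = sup_{θ ∈ K} M(ε / c⋆, B(θ, ε) ∩ K)`. -/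
def locPacking (cs : ℝ) (K : Set (Rn n)) (ε : ℝ) : ℕ∞ :=
  ⨆ θ ∈ K, ballPacking cs K θ ε

/-- The logarithm of a packing number. For `ε, c⋆ > 0` the two packing numbers above are finite
(in fact at most `(1 + 2 c⋆)ⁿ`), so that `toNat` loses nothing. -/
def logCard (M : ℕ∞) : ℝ := Real.log (M.toNat : ℝ)

/-- `sup_{μ ∈ K} w_μ(ε) / ε ≤ A √(log M^loc(c ε))` for all `0 < ε ≤ d`, where `d ∈ [0, ∞]` is the
diameter of `K`. -/
def WidthEntropyCondition (cs A c : ℝ) (K : Set (Rn n)) : Prop :=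
  ∀ ε : ℝ, 0 < ε → ENNReal.ofReal ε ≤ Metric.ediam K → ∀ μ ∈ K,
    localWidth K μ ε / ε ≤ A * √(logCard (locPacking cs K (c * ε)))

/-- The same condition, with both sides looked at around the point `0` only:
`w_0(ε) / ε ≤ A √(log M(c ε / c⋆, B(0, c ε) ∩ K))` for all `0 < ε ≤ d`. -/
def WidthEntropyConditionAtZero (cs A c : ℝ) (K : Set (Rn n)) : Prop :=
  ∀ ε : ℝ, 0 < ε → ENNReal.ofReal ε ≤ Metric.ediam K →
    localWidth K 0 ε / ε ≤ A * √(logCard (ballPacking cs K 0 (c * ε)))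

/-- `p` minimizes `ν ↦ ‖y - ν‖²` over `ν ∈ K`. -/
def IsLeastSquares (K : Set (Rn n)) (y p : Rn n) : Prop :=
  p ∈ K ∧ ∀ ν ∈ K, ‖y - p‖ ^ 2 ≤ ‖y - ν‖ ^ 2

/-- The least squares estimator `μ̂(y) = argmin_{ν ∈ K} ‖y - ν‖²`. -/
def lse (K : Set (Rn n)) (y : Rn n) : Rn n :=
  Classical.epsilon (IsLeastSquares K y)

/-- For a non-empty closed convex `K` the minimizer exists, so `lse K y` is one. -/
theorem isLeastSquares_lse {K : Set (Rn n)} (hne : K.Nonempty) (hcl : IsClosed K)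
    (hK : Convex ℝ K) (y : Rn n) : IsLeastSquares K y (lse K y) := by
  refine Classical.epsilon_spec (p := IsLeastSquares K y) ?_
  obtain ⟨p, hp, hmin⟩ := exists_norm_eq_iInf_of_complete_convex hne hcl.isComplete hK y
  refine ⟨p, hp, fun ν hν => ?_⟩
  have h : ‖y - p‖ ≤ ‖y - ν‖ := by
    rw [hmin]
    exact ciInf_le ⟨0, by rintro _ ⟨w, rfl⟩; positivity⟩ (⟨ν, hν⟩ : K)
  gcongr

/-- The law of the observation `Y = μ + ξ`, `ξ ∼ N(0, σ² I_n)`. -/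
def observationLaw (μ : Rn n) (σ : ℝ) : Measure (Rn n) :=
  (stdGaussian (Rn n)).map (fun x => μ + σ • x)

/-- The worst case risk `sup_{μ ∈ K} E_μ ‖f(Y) - μ‖²` of an estimator `f`. -/
def worstCaseRisk (K : Set (Rn n)) (σ : ℝ) (f : Rn n → Rn n) : ℝ≥0∞ :=
  ⨆ μ ∈ K, ∫⁻ y, ENNReal.ofReal (‖f y - μ‖ ^ 2) ∂(observationLaw μ σ)

/-- The minimax risk `inf_f sup_{μ ∈ K} E_μ ‖f(Y) - μ‖²` over all measurable estimators `f`. -/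
def minimaxRisk (K : Set (Rn n)) (σ : ℝ) : ℝ≥0∞ :=
  ⨅ (f : Rn n → Rn n) (_ : Measurable f), worstCaseRisk K σ f

end GaussianSequence

end

/-! Both risks are compared with `ε ^ 2` at one scale `ε`, read off from the minimax risk itself.

Upper bound: the projection inequality gives `‖p - μ‖² ≤ σ ⟨x, p - μ⟩` for the LSE `p`. If `p` is
farther than `ε` from `μ`, pulling it back along the segment to distance `ε` gives `‖p - μ‖ ≤ σ Z /
ε`, where `Z` is the supremum of `⟨x, t - μ⟩` over the local piece of `K`. Since `E Z² ≤ 96 (E Z)²`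
and `E Z` is the local width, the risk is at most `ε² + 96 σ² (w_μ(ε) / ε)²` (`lintegral_lse_le`),
and (1) turns the width into local entropy.

Lower bound: Cameron–Martin and Cauchy–Schwarz bound the probability of an event under a nearby mean
by the square root of its probability under `θ`. Among many separated means some event "the estimate
is close to `ν`" is rare under `θ`, hence has probability at most `1/2` under `ν`. So the minimax
risk is at least `ε² / (8 cs²)` once the local entropy exceeds both `2 (ε / σ)²` and `4 log 2`
(`le_minimaxRisk`).

Combination: take `ε² / (8 cs²)` just above the minimax risk. The lower bound must fail at `ε`, so
either `ε` is at least the diameter, and the LSE error is trivially at most `ε`, or the entropy is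
below `2 (ε / σ)²`. Local entropy is nonincreasing for convex `K`, so the upper bound at scale `max
1 (1 / c) * ε` is a constant times `ε²`.

For symmetric `K` the map `x ↦ (x - θ) / 2` carries `K` into itself and the ball around `θ` to a
ball of half the radius around `0`, which compares widths and packings at `θ` with those at `0`. -/

noncomputable section

namespace GaussianSequence

/-! ### Shifts of the standard Gaussian measure -/

section CameronMartin

variable {n : ℕ}

/-- The complex moment generating function of the standard Gaussian measure. -/
theorem integral_cexp_sum_stdGaussian (z : Fin n → ℂ) :
    ∫ x : Rn n, Complex.exp (∑ j, z j * (x j : ℂ)) ∂(stdGaussian (Rn n)) =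
      Complex.exp (∑ j, z j ^ 2 / 2) := by
  rw [← map_pi_eq_stdGaussian, integral_map (by fun_prop) (by fun_prop)]
  simp_rw [Complex.exp_sum]
  rw [integral_fintype_prod_eq_prod (f := fun (j : Fin n) (x : ℝ) ↦ Complex.exp (z j * (x : ℂ)))]
  refine Finset.prod_congr rfl fun j _ => ?_
  have h := complexMGF_id_gaussianReal (μ := 0) (v := 1) (z j)
  simpa [complexMGF] using h

theorem inner_eq_sum_mul (x y : Rn n) : inner ℝ x y = ∑ j, y j * x j := by
  simp [PiLp.inner_apply]

theorem integral_exp_inner_stdGaussian (h : Rn n) :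
    ∫ x : Rn n, Real.exp (inner ℝ h x) ∂(stdGaussian (Rn n)) = Real.exp (‖h‖ ^ 2 / 2) := by
  have key := integral_cexp_sum_stdGaussian (fun j => (h j : ℂ))
  have : ∀ x : Rn n, Complex.exp (∑ j, (h j : ℂ) * (x j : ℂ)) =
      ((Real.exp (inner ℝ h x) : ℝ) : ℂ) := by
    intro x
    rw [real_inner_comm, inner_eq_sum_mul]; push_cast; rfl
  simp_rw [this] at key
  rw [integral_complex_ofReal] at key
  apply Complex.ofReal_injective
  rw [key, EuclideanSpace.real_norm_sq_eq, Finset.sum_div]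
  push_cast; rfl

theorem integrable_exp_inner_stdGaussian (h : Rn n) :
    Integrable (fun x : Rn n => Real.exp (inner ℝ h x)) (stdGaussian (Rn n)) := by
  -- The Bochner integral of a non-integrable function is `0`, so the positive value just computed
  -- gives integrability.
  refine Integrable.of_integral_ne_zero ?_
  rw [integral_exp_inner_stdGaussian]
  positivity

/-- The Cameron–Martin formula: a shifted Gaussian measure is an exponential tilting. -/
theorem map_add_stdGaussian (h : Rn n) :
    (stdGaussian (Rn n)).map (fun x => h + x) =
      (stdGaussian (Rn n)).tilted (fun x => inner ℝ h x) := by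
  have := isProbabilityMeasure_tilted (integrable_exp_inner_stdGaussian h)
  have : IsProbabilityMeasure ((stdGaussian (Rn n)).map (fun x => h + x)) :=
    Measure.isProbabilityMeasure_map (by fun_prop)
  -- Both characteristic functions are values of the complex moment generating function, at `i t`
  -- and at `h + i t`.
  apply Measure.ext_of_charFun
  ext t
  rw [charFun_apply, charFun_apply, integral_map (by fun_prop) (by fun_prop), integral_tilted,
    integral_exp_inner_stdGaussian]
  have e1 : ∀ x : Rn n, Complex.exp (inner ℝ (h + x) t * Complex.I) =
      Complex.exp (inner ℝ h t * Complex.I) *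
        Complex.exp (∑ j, (t j * Complex.I) * (x j : ℂ)) := by
    intro x
    rw [← Complex.exp_add, inner_add_left, inner_eq_sum_mul x t]
    push_cast
    rw [add_mul, Finset.sum_mul]
    congr 2
    exact Finset.sum_congr rfl fun j _ => by ring
  have e2 : ∀ x : Rn n, (Real.exp (inner ℝ h x) / Real.exp (‖h‖ ^ 2 / 2)) •
      Complex.exp (inner ℝ x t * Complex.I) =
      Complex.exp (-(‖h‖ ^ 2 / 2 : ℝ)) *
        Complex.exp (∑ j, (h j + t j * Complex.I) * (x j : ℂ)) := by
    intro x
    rw [← Real.exp_sub, Complex.real_smul, Complex.ofReal_exp, ← Complex.exp_add,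
      ← Complex.exp_add, inner_eq_sum_mul x t, real_inner_comm, inner_eq_sum_mul x h]
    push_cast
    simp_rw [add_mul, Finset.sum_add_distrib, Finset.sum_mul]
    congr 1
    rw [Finset.sum_congr rfl fun j _ => (by ring :
      (t j : ℂ) * Complex.I * (x j : ℂ) = (t j : ℂ) * (x j : ℂ) * Complex.I)]
    ring
  simp_rw [e1, e2]
  rw [integral_const_mul, integral_const_mul, integral_cexp_sum_stdGaussian,
    integral_cexp_sum_stdGaussian, ← Complex.exp_add, ← Complex.exp_add]
  congr 1
  rw [EuclideanSpace.real_norm_sq_eq, inner_eq_sum_mul h t]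
  push_cast
  rw [Finset.sum_div, Finset.sum_mul, ← Finset.sum_add_distrib, ← Finset.sum_neg_distrib,
    ← Finset.sum_add_distrib]
  refine Finset.sum_congr rfl fun j _ => ?_
  ring_nf

/-- Comparison of a shifted Gaussian measure with the centred one. -/
theorem stdGaussian_map_add_apply_le (h : Rn n) {E : Set (Rn n)} (hE : MeasurableSet E) :
    (stdGaussian (Rn n)).map (fun x => h + x) E ≤
      ENNReal.ofReal (Real.exp (‖h‖ ^ 2 / 2)) * (stdGaussian (Rn n) E) ^ (1 / 2 : ℝ) := by
  rw [map_add_stdGaussian, tilted_apply' _ _ hE, integral_exp_inner_stdGaussian]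
  set L : Rn n → ℝ := fun x => Real.exp (inner ℝ h x) / Real.exp (‖h‖ ^ 2 / 2) with hL
  have hLm : Measurable L := by fun_prop
  -- The density has second moment `exp ‖h‖²`; Cauchy–Schwarz against the indicator of `E`
  -- contributes its square root.
  have hL2 : ∫⁻ x, ENNReal.ofReal (L x) ^ (2 : ℝ) ∂(stdGaussian (Rn n)) =
      ENNReal.ofReal (Real.exp (‖h‖ ^ 2 / 2)) ^ (2 : ℝ) := by
    have e : ∀ x, ENNReal.ofReal (L x) ^ (2 : ℝ) =
        ENNReal.ofReal (Real.exp (-‖h‖ ^ 2) * Real.exp (inner ℝ ((2 : ℝ) • h) x)) := by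
      intro x
      rw [ENNReal.ofReal_rpow_of_nonneg (by positivity) (by norm_num), hL]
      dsimp only
      rw [← Real.exp_sub, ← Real.exp_add, ← Real.exp_mul, inner_smul_left]
      congr 2
      simp only [conj_trivial]
      ring
    simp_rw [e]
    rw [← ofReal_integral_eq_lintegral_ofReal
      ((integrable_exp_inner_stdGaussian _).const_mul _)
      (Filter.Eventually.of_forall fun x => by positivity), integral_const_mul,
      integral_exp_inner_stdGaussian, ENNReal.ofReal_rpow_of_nonneg (by positivity) (by norm_num),
      ← Real.exp_add, ← Real.exp_mul, norm_smul]
    congr 2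
    norm_num
    ring
  have hH := ENNReal.lintegral_mul_le_Lp_mul_Lq (stdGaussian (Rn n))
    Real.HolderConjugate.two_two (f := fun x => ENNReal.ofReal (L x))
    (g := E.indicator 1) (by fun_prop) (by fun_prop (disch := exact hE))
  have h1 : ∀ x, E.indicator (1 : Rn n → ℝ≥0∞) x ^ (2 : ℝ) = E.indicator 1 x := by
    intro x
    by_cases hx : x ∈ E <;> simp [hx]
  rw [hL2] at hH
  simp_rw [h1] at hH
  rw [lintegral_indicator_one hE, ← ENNReal.rpow_mul] at hH
  norm_num at hH
  norm_num
  refine le_trans (le_of_eq ?_) hH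
  rw [← lintegral_indicator hE]
  refine lintegral_congr fun x => ?_
  by_cases hx : x ∈ E <;> simp [hx, hL]

end CameronMartin

/-! ### Minimax lower bound from separated hypotheses -/

section LowerBound

variable {n : ℕ}

instance isProbabilityMeasure_observationLaw (μ : Rn n) (σ : ℝ) :
    IsProbabilityMeasure (observationLaw μ σ) :=
  Measure.isProbabilityMeasure_map (by fun_prop)

theorem observationLaw_apply_le {θ ν : Rn n} {σ ε : ℝ} (hσ : 0 < σ) (hν : ‖ν - θ‖ ≤ ε)
    {E : Set (Rn n)} (hE : MeasurableSet E) :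
    observationLaw ν σ E ≤ ENNReal.ofReal (Real.exp ((ε / σ) ^ 2 / 2)) *
      (observationLaw θ σ E) ^ (1 / 2 : ℝ) := by
  have hm : Measurable (fun x : Rn n => θ + σ • x) := by fun_prop
  -- In units of the noise, replacing `θ` by `ν` is a shift by `(ν - θ) / σ`.
  have e : observationLaw ν σ E = (stdGaussian (Rn n)).map (fun x => σ⁻¹ • (ν - θ) + x)
      ((fun x : Rn n => θ + σ • x) ⁻¹' E) := by
    rw [observationLaw, Measure.map_apply (by fun_prop) hE,
      Measure.map_apply (by fun_prop) (hm hE)]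
    congr 1
    ext x
    simp only [Set.mem_preimage]
    rw [smul_add, smul_inv_smul₀ hσ.ne']
    rw [show θ + (ν - θ + σ • x) = ν + σ • x by abel]
  rw [e, observationLaw, Measure.map_apply hm hE]
  refine (stdGaussian_map_add_apply_le _ (hm hE)).trans ?_
  gcongr
  rw [norm_smul, norm_inv, Real.norm_of_nonneg hσ.le, inv_mul_eq_div]
  gcongr

/-- A lower bound for the minimax risk by a separated set of hypotheses in a ball. -/
theorem le_minimaxRisk_of_separated {K : Set (Rn n)} {θ : Rn n} {σ ε δ : ℝ} (hσ : 0 < σ)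
    (hδ : 0 ≤ δ) {t : Finset (Rn n)} (htne : t.Nonempty) (htK : ∀ ν ∈ t, ν ∈ K)
    (htε : ∀ ν ∈ t, ‖ν - θ‖ ≤ ε) (hsep : ∀ ν ∈ t, ∀ ν' ∈ t, ν ≠ ν' → 2 * δ ≤ dist ν ν')
    (hcard : 2 * Real.exp ((ε / σ) ^ 2 / 2) ≤ √(t.card : ℝ)) :
    ENNReal.ofReal (δ ^ 2 / 2) ≤ minimaxRisk K σ := by
  refine le_iInf₂ fun f hf => ?_
  set E : Rn n → Set (Rn n) := fun ν => f ⁻¹' Metric.ball ν δ with hE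
  have hEm : ∀ ν, MeasurableSet (E ν) := fun ν => hf measurableSet_ball
  have hdisj : (t : Set (Rn n)).PairwiseDisjoint E := by
    intro ν hν ν' hν' hne
    exact (Metric.ball_disjoint_ball (by linarith [hsep ν hν ν' hν' hne])).preimage f
  have hsum : ∑ ν ∈ t, observationLaw θ σ (E ν) ≤ ∑ ν ∈ t, (t.card : ℝ≥0∞)⁻¹ := by
    rw [← measure_biUnion_finset hdisj fun ν _ => hEm ν, Finset.sum_const, nsmul_eq_mul,
      ENNReal.mul_inv_cancel (by simpa using htne.ne_empty) (by simp)]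
    exact prob_le_one
  -- Pigeonhole: the events are disjoint, so under the central law one of them has at most the
  -- average probability.
  obtain ⟨ν, hν, hle⟩ : ∃ ν ∈ t, observationLaw θ σ (E ν) ≤ (t.card : ℝ≥0∞)⁻¹ := by
    by_contra! hlt
    exact (ENNReal.sum_lt_sum_of_nonempty htne hlt).not_ge hsum
  have hP : observationLaw ν σ (E ν) ≤ 2⁻¹ := by
    refine (observationLaw_apply_le hσ (htε ν hν) (hEm ν)).trans ?_
    have hN : 0 < (t.card : ℝ) := by exact_mod_cast htne.card_pos
    calc _ ≤ ENNReal.ofReal (Real.exp ((ε / σ) ^ 2 / 2)) *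
          ((t.card : ℝ≥0∞)⁻¹) ^ (1 / 2 : ℝ) := by gcongr
      _ = ENNReal.ofReal (Real.exp ((ε / σ) ^ 2 / 2) * (√(t.card : ℝ))⁻¹) := by
          rw [ENNReal.ofReal_mul (by positivity), Real.sqrt_eq_rpow, ← Real.inv_rpow hN.le,
            ← ENNReal.ofReal_rpow_of_pos (by positivity), ENNReal.ofReal_inv_of_pos hN,
            ENNReal.ofReal_natCast]
      _ ≤ ENNReal.ofReal (2⁻¹) := by
          apply ENNReal.ofReal_le_ofReal
          rw [← div_eq_mul_inv, div_le_iff₀ (by positivity)]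
          linarith
      _ = 2⁻¹ := by rw [ENNReal.ofReal_inv_of_pos (by norm_num)]; norm_num
  have hPc : 2⁻¹ ≤ observationLaw ν σ (E ν)ᶜ := by
    rw [prob_compl_eq_one_sub (hEm ν)]
    refine le_trans ?_ (tsub_le_tsub_left hP 1)
    rw [ENNReal.one_sub_inv_two]
  refine le_trans ?_ (le_iSup₂ (f := fun μ (_ : μ ∈ K) =>
    ∫⁻ y, ENNReal.ofReal (‖f y - μ‖ ^ 2) ∂(observationLaw μ σ)) ν (htK ν hν))
  calc ENNReal.ofReal (δ ^ 2 / 2) = ENNReal.ofReal (δ ^ 2) * 2⁻¹ := by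
        rw [div_eq_mul_inv, ENNReal.ofReal_mul (by positivity),
          ENNReal.ofReal_inv_of_pos (by norm_num)]
        norm_num
    _ ≤ ENNReal.ofReal (δ ^ 2) * observationLaw ν σ (E ν)ᶜ := by gcongr
    _ ≤ ENNReal.ofReal (δ ^ 2) * observationLaw ν σ
          {y | ENNReal.ofReal (δ ^ 2) ≤ ENNReal.ofReal (‖f y - ν‖ ^ 2)} := by
        gcongr
        intro y hy
        simp only [hE, Set.mem_compl_iff, Set.mem_preimage, Metric.mem_ball, not_lt,
          dist_eq_norm] at hy
        simp only [Set.mem_ofPred_eq]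
        gcongr
    _ ≤ _ := mul_meas_ge_le_lintegral (by fun_prop) _

end LowerBound

/-! ### Second moments of sublinear functionals of a Gaussian vector -/

section Moments

variable {n : ℕ}

theorem map_neg_stdGaussian :
    (stdGaussian (Rn n)).map (fun x => -x) = stdGaussian (Rn n) :=
  stdGaussian_map (LinearIsometryEquiv.neg ℝ : Rn n ≃ₗᵢ[ℝ] Rn n)

/-- Comparison of the first two moments of a seminorm of a Gaussian vector. -/
theorem lintegral_sq_seminorm_le {q : Rn n → ℝ} (hqm : Measurable q) (hq0 : ∀ x, 0 ≤ q x)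
    (hadd : ∀ x y, q (x + y) ≤ q x + q y) (hsmul : ∀ (r : ℝ) x, q (r • x) = |r| * q x)
    (hint : Integrable q (stdGaussian (Rn n))) :
    ∫⁻ x, ENNReal.ofReal (q x ^ 2) ∂(stdGaussian (Rn n)) ≤
      ENNReal.ofReal (24 * (∫ x, q x ∂(stdGaussian (Rn n))) ^ 2) := by
  set γ := stdGaussian (Rn n) with hγ
  set m := ∫ x, q x ∂γ with hm
  have hm0 : 0 ≤ m := integral_nonneg hq0
  -- Markov's inequality at level `2 m` needs `m > 0`, so the degenerate case is separated.
  rcases hm0.eq_or_lt with h0 | hpos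
  · have hae : q =ᵐ[γ] 0 := (integral_eq_zero_iff_of_nonneg hq0 hint).1 h0.symm
    have : ∫⁻ x, ENNReal.ofReal (q x ^ 2) ∂γ = 0 := by
      rw [lintegral_eq_zero_iff (by fun_prop)]
      filter_upwards [hae] with x hx
      simp [hx]
    simp [this]
  set A : Set (Rn n) := {x | q x ≤ 2 * m} with hA
  have hAm : MeasurableSet A := measurableSet_le hqm measurable_const
  have hAc : γ Aᶜ ≤ 2⁻¹ := by
    have h1 := mul_meas_ge_le_lintegral (μ := γ)
      (f := fun x => ENNReal.ofReal (q x)) (by fun_prop) (ENNReal.ofReal (2 * m))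
    rw [← ofReal_integral_eq_lintegral_ofReal hint (Filter.Eventually.of_forall hq0), ← hm,
      ENNReal.ofReal_mul (by norm_num), mul_comm (ENNReal.ofReal 2), mul_assoc] at h1
    have hm' : ENNReal.ofReal m ≠ 0 := by simpa using hpos
    have h2 : ENNReal.ofReal 2 * γ {x | ENNReal.ofReal m * ENNReal.ofReal 2 ≤
        ENNReal.ofReal (q x)} ≤ 1 := by
      rw [← ENNReal.mul_le_mul_iff_right hm' ENNReal.ofReal_ne_top, mul_one]
      exact h1
    rw [ENNReal.le_inv_iff_mul_le, mul_comm]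
    refine le_trans ?_ h2
    rw [ENNReal.ofReal_ofNat]
    gcongr
    intro x hx
    simp only [hA, Set.mem_compl_iff, Set.mem_ofPred_eq, not_le] at hx ⊢
    rw [← ENNReal.ofReal_ofNat, ← ENNReal.ofReal_mul hm0]
    exact ENNReal.ofReal_le_ofReal (by linarith)
  have hA2 : 2⁻¹ ≤ γ A := by
    have := prob_compl_eq_one_sub (μ := γ) hAm.compl
    rw [compl_compl] at this
    rw [this, ← ENNReal.one_sub_inv_two]
    exact tsub_le_tsub_left hAc 1
  -- Rotating an independent pair by `π / 4` preserves its law. On the event that one rotated vector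
  -- lies in `A`, the square of `q` at the other is bounded through the product `q x * q y`, whose
  -- mean factors. Thus only first moments enter, and finiteness of the second moment need not be
  -- known beforehand.
  have hrot := IsGaussian.map_rotation_eq_self_of_forall_strongDual_eq_zero (μ := γ)
    (fun L => integral_strongDual_stdGaussian L) (Real.pi / 4)
  have hprod : γ A * ∫⁻ x, ENNReal.ofReal (q x ^ 2) ∂γ ≤
      ENNReal.ofReal (2 * (2 * m) ^ 2 + 4 * (m * m)) := by
    calc γ A * ∫⁻ x, ENNReal.ofReal (q x ^ 2) ∂γ
        = ∫⁻ z, A.indicator 1 z.1 * ENNReal.ofReal (q z.2 ^ 2) ∂(γ.prod γ) := by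
          rw [lintegral_prod_mul (f := A.indicator 1) (g := fun x => ENNReal.ofReal (q x ^ 2))
            (measurable_one.indicator hAm).aemeasurable (by fun_prop),
            lintegral_indicator_one hAm]
      _ = ∫⁻ z, A.indicator 1 (ContinuousLinearMap.rotation (Real.pi / 4) z).1 *
            ENNReal.ofReal (q (ContinuousLinearMap.rotation (Real.pi / 4) z).2 ^ 2)
              ∂(γ.prod γ) := by
          conv_lhs => rw [← hrot]
          rw [lintegral_map]
          · exact ((measurable_one.indicator hAm).comp measurable_fst).mul (by fun_prop)
          · fun_prop
      _ ≤ ∫⁻ z, (ENNReal.ofReal (2 * (2 * m) ^ 2) +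
            4 * (ENNReal.ofReal (q z.1) * ENNReal.ofReal (q z.2))) ∂(γ.prod γ) := by
          refine lintegral_mono fun z => ?_
          obtain ⟨x, y⟩ := z
          rw [ContinuousLinearMap.rotation_apply, Real.cos_pi_div_four, Real.sin_pi_div_four]
          dsimp only
          set u := (√2 / 2) • x + (√2 / 2) • y with hu
          set v := -(√2 / 2) • x + (√2 / 2) • y with hv
          have hs : √2 * √2 = 2 := Real.mul_self_sqrt (by norm_num)
          by_cases hmem : u ∈ A
          swap
          · simp [hmem]
          rw [Set.indicator_of_mem hmem, Pi.one_apply, one_mul, ← ENNReal.ofReal_mul (hq0 _),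
            ← ENNReal.ofReal_ofNat, ← ENNReal.ofReal_mul (by norm_num),
            ← ENNReal.ofReal_add (by positivity)
              (mul_nonneg (by norm_num) (mul_nonneg (hq0 _) (hq0 _)))]
          apply ENNReal.ofReal_le_ofReal
          have hmem' : q u ≤ 2 * m := hmem
          -- Two expressions for `v` bound `q v - q u` by both `√2 * q x` and `√2 * q y`;
          -- multiplying them gives `(q v - q u)² ≤ 2 * q x * q y` when the difference is
          -- nonnegative.
          have e1 : v = u + (-√2) • x := by rw [hu, hv]; module
          have e2 : v = (-1 : ℝ) • u + √2 • y := by rw [hu, hv]; module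
          have i1 : q v ≤ q u + √2 * q x := by
            have := hadd u ((-√2) • x)
            rw [← e1, hsmul, abs_neg, abs_of_nonneg (Real.sqrt_nonneg 2)] at this
            exact this
          have i2 : q v ≤ q u + √2 * q y := by
            have := hadd ((-1 : ℝ) • u) (√2 • y)
            rw [← e2, hsmul, hsmul, abs_neg, abs_one, one_mul,
              abs_of_nonneg (Real.sqrt_nonneg 2)] at this
            exact this
          have hxy : 0 ≤ q x * q y := mul_nonneg (hq0 _) (hq0 _)
          have huu : q u ^ 2 ≤ (2 * m) ^ 2 := by
            have := hq0 u
            gcongr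
          rcases le_total (q v) (q u) with h | h
          · have : q v ^ 2 ≤ q u ^ 2 := by
              have := hq0 v
              gcongr
            nlinarith [sq_nonneg m]
          · have : (q v - q u) * (q v - q u) ≤ (√2 * q x) * (√2 * q y) :=
              mul_le_mul (by linarith) (by linarith) (by linarith)
                (mul_nonneg (Real.sqrt_nonneg 2) (hq0 x))
            have e3 : (√2 * q x) * (√2 * q y) = 2 * (q x * q y) := by
              linear_combination (q x * q y) * hs
            nlinarith [sq_nonneg (q v - 2 * q u)]
      _ = ENNReal.ofReal (2 * (2 * m) ^ 2 + 4 * (m * m)) := by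
          rw [lintegral_add_left measurable_const, lintegral_const,
            lintegral_const_mul _ (by fun_prop),
            lintegral_prod_mul (f := fun x => ENNReal.ofReal (q x))
              (g := fun x => ENNReal.ofReal (q x)) (by fun_prop) (by fun_prop),
            ← ofReal_integral_eq_lintegral_ofReal hint (Filter.Eventually.of_forall hq0), ← hm,
            measure_univ, mul_one, ENNReal.ofReal_add (by positivity) (by positivity),
            ENNReal.ofReal_mul (p := 4) (by norm_num), ENNReal.ofReal_mul (p := m) hm0,
            ENNReal.ofReal_ofNat]
  calc ∫⁻ x, ENNReal.ofReal (q x ^ 2) ∂γ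
      = 2 * (2⁻¹ * ∫⁻ x, ENNReal.ofReal (q x ^ 2) ∂γ) := by
        rw [← mul_assoc, ENNReal.mul_inv_cancel (by norm_num) (by norm_num), one_mul]
    _ ≤ 2 * (γ A * ∫⁻ x, ENNReal.ofReal (q x ^ 2) ∂γ) := by gcongr
    _ ≤ 2 * ENNReal.ofReal (2 * (2 * m) ^ 2 + 4 * (m * m)) := by gcongr
    _ = ENNReal.ofReal (24 * m ^ 2) := by
        rw [← ENNReal.ofReal_ofNat, ← ENNReal.ofReal_mul (by norm_num)]
        congr 1
        ring

/-- Comparison of the first two moments of a nonnegative sublinear functional of a Gaussian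
vector. -/
theorem lintegral_sq_sublinear_le {p : Rn n → ℝ} (hpm : Measurable p) (hp0 : ∀ x, 0 ≤ p x)
    (hadd : ∀ x y, p (x + y) ≤ p x + p y) (hsmul : ∀ (r : ℝ) x, 0 ≤ r → p (r • x) = r * p x)
    (hint : Integrable p (stdGaussian (Rn n))) :
    ∫⁻ x, ENNReal.ofReal (p x ^ 2) ∂(stdGaussian (Rn n)) ≤
      ENNReal.ofReal (96 * (∫ x, p x ∂(stdGaussian (Rn n))) ^ 2) := by
  have hmp : MeasurePreserving (fun x : Rn n => -x) (stdGaussian (Rn n)) (stdGaussian (Rn n)) :=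
    ⟨measurable_neg, map_neg_stdGaussian⟩
  have hint' : Integrable (fun x => p (-x)) (stdGaussian (Rn n)) :=
    hmp.integrable_comp_of_integrable hint
  have hI : ∫ x, p (-x) ∂(stdGaussian (Rn n)) = ∫ x, p x ∂(stdGaussian (Rn n)) :=
    hmp.integral_comp (Homeomorph.neg (Rn n)).measurableEmbedding p
  -- Symmetrizing doubles the mean, so the constant becomes `24 * 2 ^ 2 = 96`.
  have h := lintegral_sq_seminorm_le (q := fun x => p x + p (-x)) (by fun_prop)
    (fun x => add_nonneg (hp0 _) (hp0 _))
    (fun x y => by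
      have h1 := hadd x y
      have h2 := hadd (-x) (-y)
      rw [← neg_add] at h2
      linarith)
    (fun r x => by
      rcases le_total 0 r with hr | hr
      · rw [← smul_neg, hsmul _ _ hr, hsmul _ _ hr, abs_of_nonneg hr]; ring
      · have hr' : 0 ≤ -r := by linarith
        rw [← neg_smul, hsmul (-r) _ hr', ← neg_smul_neg, hsmul (-r) _ hr', abs_of_nonpos hr]
        ring)
    (hint.add hint')
  rw [integral_add hint hint', hI] at h
  refine le_trans (lintegral_mono fun x => ?_) (h.trans (le_of_eq ?_))
  · have := hp0 x
    have := hp0 (-x)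
    apply ENNReal.ofReal_le_ofReal
    gcongr
    linarith
  · congr 1
    ring

end Moments

/-! ### Risk of the LSE through the local Gaussian width -/

section LeastSquares

variable {n : ℕ}

/-- The support function of a set. -/
def supportFunction (T : Set (Rn n)) (x : Rn n) : ℝ := ⨆ t : T, inner ℝ x (t : Rn n)

theorem bddAbove_range_inner {T : Set (Rn n)} (hT : Bornology.IsBounded T) (x : Rn n) :
    BddAbove (Set.range fun t : T => inner ℝ x (t : Rn n)) := by
  obtain ⟨R, hR⟩ := hT.exists_norm_le
  refine ⟨‖x‖ * R, ?_⟩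
  rintro _ ⟨t, rfl⟩
  exact (real_inner_le_norm _ _).trans (by gcongr; exact hR t t.2)

theorem inner_le_supportFunction {T : Set (Rn n)} (hT : Bornology.IsBounded T) {t : Rn n}
    (ht : t ∈ T) (x : Rn n) : inner ℝ x t ≤ supportFunction T x :=
  le_ciSup (bddAbove_range_inner hT x) (⟨t, ht⟩ : T)

theorem supportFunction_le {T : Set (Rn n)} (hne : T.Nonempty) {x : Rn n} {a : ℝ}
    (h : ∀ t ∈ T, inner ℝ x t ≤ a) : supportFunction T x ≤ a :=
  have := hne.to_subtype
  ciSup_le fun t => h t t.2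

theorem measurable_supportFunction {T : Set (Rn n)} (hT : Bornology.IsBounded T) :
    Measurable (supportFunction T) :=
  (lowerSemicontinuous_ciSup (fun x => bddAbove_range_inner hT x) fun t : T =>
    (by fun_prop : Continuous fun x : Rn n => inner ℝ x (t : Rn n)).lowerSemicontinuous).measurable

theorem integrable_norm_stdGaussian : Integrable (fun x : Rn n => ‖x‖) (stdGaussian (Rn n)) :=
  (IsGaussian.integrable_id (μ := stdGaussian (Rn n))).norm

theorem integrable_inner_stdGaussian (a : Rn n) :
    Integrable (fun x : Rn n => inner ℝ x a) (stdGaussian (Rn n)) :=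
  (IsGaussian.integrable_id (μ := stdGaussian (Rn n))).inner_const a

theorem integral_inner_stdGaussian (a : Rn n) :
    ∫ x : Rn n, inner ℝ x a ∂(stdGaussian (Rn n)) = 0 := by
  have := integral_strongDual_stdGaussian (innerSL ℝ a : StrongDual ℝ (Rn n))
  simpa [innerSL_apply_apply, real_inner_comm] using this

theorem integrable_supportFunction {T : Set (Rn n)} (hne : T.Nonempty)
    (hT : Bornology.IsBounded T) : Integrable (supportFunction T) (stdGaussian (Rn n)) := by
  obtain ⟨R, hR⟩ := hT.exists_norm_le
  obtain ⟨t₀, ht₀⟩ := hne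
  refine (integrable_norm_stdGaussian.mul_const R).mono'
    (measurable_supportFunction hT).aestronglyMeasurable (Filter.Eventually.of_forall fun x => ?_)
  rw [Real.norm_eq_abs, abs_le]
  constructor
  · refine le_trans ?_ (inner_le_supportFunction hT ht₀ x)
    refine le_trans ?_ (neg_le_of_abs_le (abs_real_inner_le_norm x t₀))
    have := hR t₀ ht₀
    gcongr
  · refine supportFunction_le ⟨t₀, ht₀⟩ fun t ht => (real_inner_le_norm _ _).trans ?_
    gcongr
    exact hR t ht

/-- The second moment of the supremum of the increments around a point of the index set. -/
theorem lintegral_sq_supportFunction_sub_le {T : Set (Rn n)} (hT : Bornology.IsBounded T)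
    {μ : Rn n} (hμ : μ ∈ T) :
    ∫⁻ x, ENNReal.ofReal ((supportFunction T x - inner ℝ x μ) ^ 2) ∂(stdGaussian (Rn n)) ≤
      ENNReal.ofReal (96 * gaussianWidth T ^ 2) := by
  have hne : T.Nonempty := ⟨μ, hμ⟩
  have hint := integrable_supportFunction hne hT
  have hm := measurable_supportFunction hT
  have h := lintegral_sq_sublinear_le (p := fun x => supportFunction T x - inner ℝ x μ)
    (by fun_prop) (fun x => sub_nonneg.2 (inner_le_supportFunction hT hμ x))
    (fun x y => by
      have : supportFunction T (x + y) ≤ supportFunction T x + supportFunction T y :=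
        supportFunction_le hne fun t ht => by
          rw [inner_add_left]
          exact add_le_add (inner_le_supportFunction hT ht x) (inner_le_supportFunction hT ht y)
      rw [inner_add_left]
      linarith)
    (fun r x hr => by
      have : supportFunction T (r • x) = r * supportFunction T x := by
        simp only [supportFunction, real_inner_smul_left, Real.mul_iSup_of_nonneg hr]
      rw [this, real_inner_smul_left]
      ring)
    (hint.sub (integrable_inner_stdGaussian μ))
  rwa [integral_sub hint (integrable_inner_stdGaussian μ), integral_inner_stdGaussian,
    sub_zero] at h

variable {K : Set (Rn n)}

/-- The variational inequality for the metric projection. -/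
theorem norm_sq_lse_sub_le (hne : K.Nonempty) (hcl : IsClosed K) (hK : Convex ℝ K)
    {μ : Rn n} (hμ : μ ∈ K) (σ : ℝ) (x : Rn n) :
    ‖lse K (μ + σ • x) - μ‖ ^ 2 ≤ σ * inner ℝ x (lse K (μ + σ • x) - μ) := by
  set y := μ + σ • x with hy
  obtain ⟨hp, hmin⟩ := isLeastSquares_lse hne hcl hK y
  set p := lse K y
  have := hne.to_subtype
  have hinf : ‖y - p‖ = ⨅ w : K, ‖y - w‖ := by
    refine le_antisymm (le_ciInf fun w => ?_) ?_
    · exact le_of_sq_le_sq (hmin w w.2) (norm_nonneg _)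
    · exact ciInf_le ⟨0, by rintro _ ⟨w, rfl⟩; positivity⟩ (⟨p, hp⟩ : K)
  have h := (norm_eq_iInf_iff_real_inner_le_zero hK hp).1 hinf μ hμ
  have e : inner ℝ (y - p) (μ - p) = ‖p - μ‖ ^ 2 - σ * inner ℝ x (p - μ) := by
    rw [← real_inner_self_eq_norm_sq, ← real_inner_smul_left, ← inner_sub_left,
      ← inner_neg_neg]
    congr 1
    · rw [hy]
      abel
    · abel
  linarith

/-- If the projection is at distance at least `ε` from `μ`, the point at distance `ε` on the segment
towards it is still in `K`. Testing the supremum there bounds `⟨x, p - μ⟩` by `‖p - μ‖ * Z / ε`, and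
one factor `‖p - μ‖` cancels in the projection inequality. -/
theorem norm_sq_lse_sub_le_add (hne : K.Nonempty) (hcl : IsClosed K) (hK : Convex ℝ K)
    {μ : Rn n} (hμ : μ ∈ K) {σ ε : ℝ} (hσ : 0 < σ) (hε : 0 < ε) (x : Rn n) :
    ‖lse K (μ + σ • x) - μ‖ ^ 2 ≤ ε ^ 2 + σ ^ 2 / ε ^ 2 *
      (supportFunction (Metric.closedBall μ ε ∩ K) x - inner ℝ x μ) ^ 2 := by
  have hb : Bornology.IsBounded (Metric.closedBall μ ε ∩ K) :=
    Metric.isBounded_closedBall.subset Set.inter_subset_left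
  have h := norm_sq_lse_sub_le hne hcl hK hμ σ x
  have hp := (isLeastSquares_lse hne hcl hK (μ + σ • x)).1
  set p := lse K (μ + σ • x)
  set Z := supportFunction (Metric.closedBall μ ε ∩ K) x - inner ℝ x μ with hZ
  rcases le_total ‖p - μ‖ ε with hle | hle
  · have : ‖p - μ‖ ^ 2 ≤ ε ^ 2 := by gcongr
    have : 0 ≤ σ ^ 2 / ε ^ 2 * Z ^ 2 := by positivity
    linarith
  have hD : 0 < ‖p - μ‖ := hε.trans_le hle
  have hmem : μ + (ε / ‖p - μ‖) • (p - μ) ∈ Metric.closedBall μ ε ∩ K := by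
    refine ⟨?_, hK.add_smul_sub_mem hμ hp ⟨by positivity, (div_le_one hD).2 hle⟩⟩
    rw [mem_closedBall_iff_norm, add_sub_cancel_left, norm_smul, Real.norm_of_nonneg (by positivity),
      div_mul_cancel₀ _ hD.ne']
  have h1 := inner_le_supportFunction hb hmem x
  rw [inner_add_right, real_inner_smul_right] at h1
  have h2 : inner ℝ x (p - μ) ≤ ‖p - μ‖ * Z / ε := by
    rw [le_div_iff₀ hε]
    have h3 : ε / ‖p - μ‖ * inner ℝ x (p - μ) ≤ Z := by linarith
    rw [div_mul_eq_mul_div, div_le_iff₀ hD] at h3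
    linarith
  have h4 : ‖p - μ‖ ≤ σ * Z / ε := by
    have : ‖p - μ‖ * ‖p - μ‖ ≤ ‖p - μ‖ * (σ * Z / ε) := by
      calc _ = ‖p - μ‖ ^ 2 := by ring
        _ ≤ σ * (‖p - μ‖ * Z / ε) := h.trans (by gcongr)
        _ = _ := by ring
    exact le_of_mul_le_mul_left this hD
  calc ‖p - μ‖ ^ 2 ≤ (σ * Z / ε) ^ 2 := by gcongr
    _ = σ ^ 2 / ε ^ 2 * Z ^ 2 := by ring
    _ ≤ _ := le_add_of_nonneg_left (by positivity)

/-- The risk of the least squares estimator is controlled by a local Gaussian width. -/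
theorem lintegral_lse_le (hne : K.Nonempty) (hcl : IsClosed K) (hK : Convex ℝ K)
    {μ : Rn n} (hμ : μ ∈ K) {σ ε : ℝ} (hσ : 0 < σ) (hε : 0 < ε) :
    ∫⁻ y, ENNReal.ofReal (‖lse K y - μ‖ ^ 2) ∂(observationLaw μ σ) ≤
      ENNReal.ofReal (ε ^ 2 + 96 * σ ^ 2 * (localWidth K μ ε / ε) ^ 2) := by
  have hb : Bornology.IsBounded (Metric.closedBall μ ε ∩ K) :=
    Metric.isBounded_closedBall.subset Set.inter_subset_left
  have hm := measurable_supportFunction hb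
  calc ∫⁻ y, ENNReal.ofReal (‖lse K y - μ‖ ^ 2) ∂(observationLaw μ σ)
      ≤ ∫⁻ x, ENNReal.ofReal (‖lse K (μ + σ • x) - μ‖ ^ 2) ∂(stdGaussian (Rn n)) :=
        -- This direction of the change of variables requires no measurability of `lse K`.
        lintegral_map_le _ _
    _ ≤ ∫⁻ x, (ENNReal.ofReal (ε ^ 2) + ENNReal.ofReal (σ ^ 2 / ε ^ 2) *
          ENNReal.ofReal ((supportFunction (Metric.closedBall μ ε ∩ K) x - inner ℝ x μ) ^ 2))
            ∂(stdGaussian (Rn n)) := by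
        refine lintegral_mono fun x => ?_
        rw [← ENNReal.ofReal_mul (by positivity),
          ← ENNReal.ofReal_add (by positivity) (by positivity)]
        exact ENNReal.ofReal_le_ofReal (norm_sq_lse_sub_le_add hne hcl hK hμ hσ hε x)
    _ ≤ ENNReal.ofReal (ε ^ 2) + ENNReal.ofReal (σ ^ 2 / ε ^ 2) *
          ENNReal.ofReal (96 * localWidth K μ ε ^ 2) := by
        rw [lintegral_add_left measurable_const, lintegral_const_mul _ (by fun_prop),
          lintegral_const, measure_univ, mul_one]
        gcongr
        exact lintegral_sq_supportFunction_sub_le hb ⟨Metric.mem_closedBall_self hε.le, hμ⟩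
    _ = _ := by
        rw [← ENNReal.ofReal_mul (by positivity),
          ← ENNReal.ofReal_add (by positivity) (by positivity)]
        congr 1
        ring

theorem worstCaseRisk_lse_le_of_ediam (hne : K.Nonempty) (hcl : IsClosed K) (hK : Convex ℝ K)
    {σ r : ℝ} (hd : Metric.ediam K ≤ ENNReal.ofReal r) :
    worstCaseRisk K σ (lse K) ≤ ENNReal.ofReal (r ^ 2) := by
  refine iSup₂_le fun μ hμ => ?_
  have h : ∀ y, ENNReal.ofReal (‖lse K y - μ‖ ^ 2) ≤ ENNReal.ofReal (r ^ 2) := by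
    intro y
    have h1 := (Metric.edist_le_ediam_of_mem (isLeastSquares_lse hne hcl hK y).1 hμ).trans hd
    rw [edist_dist, dist_eq_norm] at h1
    rw [ENNReal.ofReal_pow (norm_nonneg _)]
    refine (pow_le_pow_left' h1 2).trans ?_
    rcases le_total 0 r with hr | hr
    · rw [ENNReal.ofReal_pow hr]
    · simp [ENNReal.ofReal_of_nonpos hr]
  refine (lintegral_mono h).trans ?_
  simp

end LeastSquares

/-! ### Local packing numbers and the entropy lower bound -/

section LocalEntropy

variable {n : ℕ} {K : Set (Rn n)} {cs ε : ℝ}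

/-- Finiteness of `N` matters because `toNat` sends `⊤` to `0`. -/
theorem logCard_mono {M N : ℕ∞} (h : M ≤ N) (hN : N ≠ ⊤) : logCard M ≤ logCard N := by
  have hMN : M.toNat ≤ N.toNat := ENat.toNat_le_toNat h hN
  rcases Nat.eq_zero_or_pos M.toNat with h0 | h0
  · rw [logCard, logCard, h0, Nat.cast_zero, Real.log_zero]
    exact Real.log_natCast_nonneg _
  · exact Real.log_le_log (by exact_mod_cast h0) (by exact_mod_cast hMN)

theorem packingNumber_le_of_forall_lt_edist {X Y : Type*} [PseudoEMetricSpace X]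
    [PseudoEMetricSpace Y] {δ δ' : ℝ≥0} {A : Set X} {B : Set Y} {f : X → Y}
    (hf : Set.MapsTo f A B)
    (hsep : ∀ x ∈ A, ∀ y ∈ A, (δ : ℝ≥0∞) < edist x y → (δ' : ℝ≥0∞) < edist (f x) (f y)) :
    Metric.packingNumber δ A ≤ Metric.packingNumber δ' B := by
  refine iSup₂_le fun C hC => iSup_le fun hCs => ?_
  have hinj : Set.InjOn f C := by
    intro x hx y hy hxy
    by_contra hne
    have := hsep x (hC hx) y (hC hy) (hCs hx hy hne)
    simp [hxy] at this
  rw [← hinj.encard_image]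
  refine Metric.IsSeparated.encard_le_packingNumber (hf.image_subset.trans' (Set.image_mono hC)) ?_
  rintro _ ⟨x, hx, rfl⟩ _ ⟨y, hy, rfl⟩ hne
  exact hsep x (hC hx) y (hC hy) (hCs hx hy fun h => hne (by rw [h]))

/-- Local packing numbers under a dilation `x ↦ θ' + r (x - θ)`. -/
theorem ballPacking_le_of_dilation {L : Set (Rn n)} {θ θ' : Rn n} {r : ℝ} (hr : 0 < r)
    (h : ∀ x ∈ K, x ∈ Metric.closedBall θ ε → θ' + r • (x - θ) ∈ L) :
    ballPacking cs K θ ε ≤ ballPacking cs L θ' (r * ε) := by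
  refine packingNumber_le_of_forall_lt_edist (f := fun x => θ' + r • (x - θ)) ?_ ?_
  · rintro x ⟨hx, hxK⟩
    refine ⟨?_, h x hxK hx⟩
    rw [mem_closedBall_iff_norm] at hx ⊢
    rw [add_sub_cancel_left, norm_smul, Real.norm_of_nonneg hr.le]
    gcongr
  · intro x _ y _ hxy
    have e : edist (θ' + r • (x - θ)) (θ' + r • (y - θ)) = ENNReal.ofReal r * edist x y := by
      rw [edist_dist, edist_dist, dist_eq_norm, dist_eq_norm, ← ENNReal.ofReal_mul hr.le]
      congr 1
      rw [show θ' + r • (x - θ) - (θ' + r • (y - θ)) = r • (x - y) by module, norm_smul,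
        Real.norm_of_nonneg hr.le]
    have e2 : (((r * ε / cs).toNNReal : ℝ≥0) : ℝ≥0∞) =
        ENNReal.ofReal r * (((ε / cs).toNNReal : ℝ≥0) : ℝ≥0∞) := by
      rw [mul_div_assoc, Real.toNNReal_mul hr.le, ENNReal.coe_mul]
      rfl
    rw [e, e2]
    exact ENNReal.mul_lt_mul_right (by simpa using hr) ENNReal.ofReal_ne_top hxy

/-- A packing is no larger than a cover at half the scale, and by compactness the ball has a finite
one. -/
theorem ballPacking_univ_ne_top (hcs : 0 < cs) (hε : 0 < ε) :
    ballPacking cs (Set.univ : Set (Rn n)) 0 ε ≠ ⊤ := by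
  rw [ballPacking, Set.inter_univ]
  have hpos : (ε / cs / 2).toNNReal ≠ 0 := by
    have : 0 < ε / cs / 2 := by positivity
    simpa using this
  obtain ⟨N, -, hNf, hN⟩ := Metric.exists_finite_isCover_of_isCompact hpos
    (isCompact_closedBall (0 : Rn n) ε)
  have e : (ε / cs).toNNReal = 2 * (ε / cs / 2).toNNReal := by
    rw [← Real.toNNReal_ofNat, ← Real.toNNReal_mul (by norm_num)]
    congr 1
    ring
  rw [e]
  exact (((Metric.packingNumber_two_mul_le_externalCoveringNumber _ _).trans
    hN.externalCoveringNumber_le_encard).trans_lt hNf.encard_lt_top).ne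

theorem locPacking_ne_top (hcs : 0 < cs) (hε : 0 < ε) : locPacking cs K ε ≠ ⊤ := by
  refine ne_top_of_le_ne_top (ballPacking_univ_ne_top (n := n) hcs hε) (iSup₂_le fun θ _ => ?_)
  simpa using ballPacking_le_of_dilation (cs := cs) (ε := ε) (K := K) (L := Set.univ) (θ := θ)
    (θ' := 0) one_pos (fun _ _ _ => trivial)

theorem ballPacking_le_locPacking {θ : Rn n} (hθ : θ ∈ K) :
    ballPacking cs K θ ε ≤ locPacking cs K ε :=
  le_iSup₂ (f := fun θ (_ : θ ∈ K) => ballPacking cs K θ ε) θ hθ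

/-- The local entropy of a convex set is nonincreasing. -/
theorem logCard_locPacking_anti (hK : Convex ℝ K) (hcs : 0 < cs) {ε' : ℝ} (hε : 0 < ε)
    (hle : ε ≤ ε') : logCard (locPacking cs K ε') ≤ logCard (locPacking cs K ε) := by
  refine logCard_mono (iSup₂_le fun θ hθ => ?_) (locPacking_ne_top hcs hε)
  have hε' : 0 < ε' := hε.trans_le hle
  -- Contracting towards `θ` keeps points in the convex set `K` and scales radius and separation
  -- alike.
  have h := ballPacking_le_of_dilation (cs := cs) (ε := ε') (K := K) (L := K) (θ := θ) (θ' := θ)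
    (r := ε / ε') (by positivity)
    (fun x hx _ => hK.add_smul_sub_mem hθ hx ⟨by positivity, (div_le_one hε').2 hle⟩)
  rw [div_mul_cancel₀ _ hε'.ne'] at h
  exact h.trans (ballPacking_le_locPacking hθ)

/-- Sixteen points at spacing `ε / 16` along the segment from `p` to `q` are separated because `cs >
16`. -/
theorem sixteen_le_ballPacking (hK : Convex ℝ K) (hcs : 16 < cs) (hε : 0 < ε) {p q : Rn n}
    (hp : p ∈ K) (hq : q ∈ K) (hpq : ε ≤ dist p q) : 16 ≤ ballPacking cs K p ε := by
  have hD : 0 < ‖q - p‖ := by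
    rw [← dist_eq_norm, dist_comm]
    exact hε.trans_le hpq
  have hpq' : ε ≤ ‖q - p‖ := by rwa [← dist_eq_norm, dist_comm]
  set g : Fin 16 → Rn n := fun k => p + (k / 16 * (ε / ‖q - p‖) : ℝ) • (q - p) with hg
  have hdist : ∀ k l : Fin 16, k ≠ l → ε / cs < dist (g k) (g l) := by
    intro k l hkl
    have hkl' : (1 : ℝ) ≤ |(k : ℝ) - l| := by
      have : (1 : ℤ) ≤ |(k : ℤ) - l| := Int.one_le_abs (by omega)
      exact_mod_cast this
    have e : g k - g l = (((k : ℝ) - l) * (ε / 16 / ‖q - p‖)) • (q - p) := by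
      rw [hg]; module
    rw [dist_eq_norm, e, norm_smul, Real.norm_eq_abs, abs_mul,
      abs_of_pos (by positivity : 0 < ε / 16 / ‖q - p‖), mul_assoc, div_mul_cancel₀ _ hD.ne']
    calc ε / cs < ε / 16 := by gcongr
      _ ≤ _ := le_mul_of_one_le_left (by positivity) hkl'
  have hinj : Function.Injective g := by
    intro k l hkl
    by_contra hne
    have := hdist k l hne
    rw [hkl, dist_self] at this
    exact absurd this (not_lt.2 (by positivity))
  have hcard : (Set.range g).encard = 16 := by
    rw [← Set.image_univ, hinj.encard_image, Set.encard_univ]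
    simp
  rw [← hcard]
  refine Metric.IsSeparated.encard_le_packingNumber ?_ ?_
  · rintro _ ⟨k, rfl⟩
    have hk : (k : ℝ) / 16 ≤ 1 := by
      rw [div_le_one (by norm_num)]
      exact_mod_cast k.2.le
    have hr : ε / ‖q - p‖ ≤ 1 := (div_le_one hD).2 hpq'
    refine ⟨?_, hK.add_smul_sub_mem hp hq ⟨by positivity, mul_le_one₀ hk (by positivity) hr⟩⟩
    rw [mem_closedBall_iff_norm, hg]
    simp only [add_sub_cancel_left]
    rw [norm_smul, Real.norm_of_nonneg (by positivity), mul_assoc, div_mul_cancel₀ _ hD.ne']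
    exact mul_le_of_le_one_left hε.le hk
  · rintro _ ⟨k, rfl⟩ _ ⟨l, rfl⟩ hne
    have := hdist k l fun h => hne (by rw [h])
    rw [edist_dist]
    exact (ENNReal.ofReal_lt_ofReal_iff_of_nonneg (by positivity)).2 this

/-- The local entropy is bounded below at scales below the diameter. -/
theorem four_mul_log_two_le (hK : Convex ℝ K) (hcs : 16 < cs) (hε : 0 < ε)
    (hd : ENNReal.ofReal ε < Metric.ediam K) :
    4 * Real.log 2 ≤ logCard (locPacking cs K ε) := by
  obtain ⟨p, hp, q, hq, hpq⟩ : ∃ p ∈ K, ∃ q ∈ K, ENNReal.ofReal ε < edist p q := by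
    by_contra! h
    exact hd.not_ge (Metric.ediam_le h)
  rw [edist_dist, ENNReal.ofReal_lt_ofReal_iff_of_nonneg hε.le] at hpq
  have h16 := (sixteen_le_ballPacking hK hcs hε hp hq hpq.le).trans (ballPacking_le_locPacking hp)
  have h := logCard_mono h16 (locPacking_ne_top (by linarith) hε)
  have e : logCard 16 = 4 * Real.log 2 := by
    have : ((16 : ℕ∞).toNat : ℝ) = 2 ^ 4 := by
      rw [show (16 : ℕ∞) = ((16 : ℕ) : ℕ∞) from rfl, ENat.toNat_natCast]
      norm_num
    rw [logCard, this, Real.log_pow]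
    norm_num
  rwa [e] at h

/-- The local entropy lower bound for the minimax risk. -/
theorem le_minimaxRisk (hne : K.Nonempty) (hcs : 0 < cs) (hε : 0 < ε) {σ : ℝ} (hσ : 0 < σ)
    (h1 : 2 * (ε / σ) ^ 2 ≤ logCard (locPacking cs K ε))
    (h2 : 4 * Real.log 2 ≤ logCard (locPacking cs K ε)) :
    ENNReal.ofReal (ε ^ 2 / (8 * cs ^ 2)) ≤ minimaxRisk K σ := by
  have hfin := locPacking_ne_top (K := K) hcs hε
  have hne' := hne.to_subtype
  -- A finite supremum in `ℕ∞` is attained.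
  obtain ⟨⟨θ, hθ⟩, hθeq⟩ : ∃ θ : K, ballPacking cs K θ ε = locPacking cs K ε := by
    rw [locPacking, ← iSup_subtype''] at hfin ⊢
    exact ENat.exists_eq_iSup_of_lt_top (f := fun θ : K => ballPacking cs K θ ε) hfin.lt_top
  rw [← hθeq] at hfin h1 h2
  obtain ⟨C, hCs, hCf, hCsep, hCcard⟩ := Metric.exists_set_encard_eq_packingNumber hfin
  have hcard : logCard (ballPacking cs K θ ε) = Real.log (hCf.toFinset.card : ℝ) := by
    rw [logCard, ballPacking, ← hCcard, hCf.encard_eq_coe_toFinset_card, ENat.toNat_natCast]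
  rw [hcard] at h1 h2
  have hlog2 : 0 < Real.log 2 := Real.log_pos (by norm_num)
  have hpos : 0 < (hCf.toFinset.card : ℝ) := by
    rcases (Nat.cast_nonneg (α := ℝ) hCf.toFinset.card).eq_or_lt with h0 | h0
    · rw [← h0, Real.log_zero] at h2
      linarith
    · exact h0
  have hδ : ε ^ 2 / (8 * cs ^ 2) = (ε / (2 * cs)) ^ 2 / 2 := by
    field_simp
    norm_num
  rw [hδ]
  refine le_minimaxRisk_of_separated (t := hCf.toFinset) (θ := θ) (ε := ε) hσ (by positivity)
    ?_ ?_ ?_ ?_ ?_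
  · exact Finset.card_pos.1 (by exact_mod_cast hpos)
  · exact fun ν hν => (hCs (hCf.mem_toFinset.1 hν)).2
  · exact fun ν hν => mem_closedBall_iff_norm.1 (hCs (hCf.mem_toFinset.1 hν)).1
  · intro ν hν ν' hν' hne
    have : ENNReal.ofReal (ε / cs) < edist ν ν' :=
      hCsep (hCf.mem_toFinset.1 hν) (hCf.mem_toFinset.1 hν') hne
    rw [edist_dist] at this
    have := ((ENNReal.ofReal_lt_ofReal_iff_of_nonneg (by positivity)).1 this).le
    refine le_trans (le_of_eq ?_) this
    field_simp
  -- After logarithms, the terms `log 2` and `(ε / σ)² / 2` must fit into half the entropy; the two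
  -- hypotheses give each of them a quarter.
  · rw [← Real.exp_log hpos, ← Real.exp_half]
    nth_rewrite 1 [← Real.exp_log (two_pos : (0 : ℝ) < 2)]
    rw [← Real.exp_add, Real.exp_le_exp]
    linarith

/-- Around every point, a symmetric set is locally at most twice as wide as around `0`. -/
theorem localWidth_le_two_mul_of_symmetric (hK : Convex ℝ K) (hsymm : ∀ x ∈ K, -x ∈ K)
    (hε : 0 ≤ ε) {μ : Rn n} (hμ : μ ∈ K) :
    localWidth K μ ε ≤ 2 * localWidth K 0 (ε / 2) := by
  have hb : ∀ (μ : Rn n) (ε : ℝ), Bornology.IsBounded (Metric.closedBall μ ε ∩ K) := fun _ _ =>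
    Metric.isBounded_closedBall.subset Set.inter_subset_left
  -- Half of `t - μ` is the midpoint of `t` and `-μ`, both in `K`. The linear term `⟨x, μ⟩` left
  -- over has mean zero.
  have hmid : ∀ t ∈ Metric.closedBall μ ε ∩ K,
      (1 / 2 : ℝ) • (t - μ) ∈ Metric.closedBall 0 (ε / 2) ∩ K := by
    rintro t ⟨ht, htK⟩
    refine ⟨?_, ?_⟩
    · rw [mem_closedBall_iff_norm] at ht
      rw [mem_closedBall_zero_iff, norm_smul, Real.norm_of_nonneg (by norm_num)]
      linarith
    · have := hK htK (hsymm μ hμ) (by norm_num : (0 : ℝ) ≤ 1 / 2) (by norm_num : (0 : ℝ) ≤ 1 / 2)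
        (by norm_num)
      rwa [smul_neg, ← sub_eq_add_neg, ← smul_sub] at this
  have hμmem : μ ∈ Metric.closedBall μ ε ∩ K := ⟨Metric.mem_closedBall_self hε, hμ⟩
  have hint := integrable_supportFunction ⟨_, hmid μ hμmem⟩ (hb 0 (ε / 2))
  calc localWidth K μ ε
      ≤ ∫ x, (inner ℝ x μ + 2 * supportFunction (Metric.closedBall 0 (ε / 2) ∩ K) x)
          ∂(stdGaussian (Rn n)) := by
        refine integral_mono (integrable_supportFunction ⟨μ, hμmem⟩ (hb μ ε))
          ((integrable_inner_stdGaussian μ).add (hint.const_mul 2)) fun x => ?_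
        refine supportFunction_le ⟨μ, hμmem⟩ fun t ht => ?_
        have := inner_le_supportFunction (hb 0 (ε / 2)) (hmid t ht) x
        rw [real_inner_smul_right, inner_sub_right] at this
        linarith
    _ = 2 * localWidth K 0 (ε / 2) := by
        rw [integral_add (integrable_inner_stdGaussian μ) (hint.const_mul 2),
          integral_inner_stdGaussian, zero_add, integral_const_mul]
        rfl

theorem locPacking_le_ballPacking_zero (hK : Convex ℝ K) (hsymm : ∀ x ∈ K, -x ∈ K) :
    locPacking cs K ε ≤ ballPacking cs K 0 (ε / 2) := by
  refine iSup₂_le fun θ hθ => ?_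
  rw [show ε / 2 = 1 / 2 * ε by ring]
  refine ballPacking_le_of_dilation (by norm_num) fun x hx _ => ?_
  have := hK hx (hsymm θ hθ) (by norm_num : (0 : ℝ) ≤ 1 / 2) (by norm_num : (0 : ℝ) ≤ 1 / 2)
    (by norm_num)
  rwa [zero_add, smul_sub, sub_eq_add_neg, ← smul_neg]

end LocalEntropy

/-! ### Minimax optimality and the symmetric case -/

section Optimality

variable {n : ℕ} {K : Set (Rn n)} {cs A c : ℝ}

theorem localWidth_nonneg {μ : Rn n} (hμ : μ ∈ K) {ε : ℝ} (hε : 0 ≤ ε) :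
    0 ≤ localWidth K μ ε := by
  have hb : Bornology.IsBounded (Metric.closedBall μ ε ∩ K) :=
    Metric.isBounded_closedBall.subset Set.inter_subset_left
  have hmem : μ ∈ Metric.closedBall μ ε ∩ K := ⟨Metric.mem_closedBall_self hε, hμ⟩
  rw [← integral_inner_stdGaussian μ]
  exact integral_mono (integrable_inner_stdGaussian μ) (integrable_supportFunction ⟨μ, hmem⟩ hb)
    (inner_le_supportFunction hb hmem)

/-- The risk of the least squares estimator at a scale whose local entropy is dominated. -/
theorem worstCaseRisk_lse_le_of_logCard_le (hne : K.Nonempty) (hcl : IsClosed K) (hK : Convex ℝ K)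
    (hcond : WidthEntropyCondition cs A c K) {σ ε B : ℝ} (hσ : 0 < σ) (hε : 0 < ε)
    (hB : 0 ≤ B)
    (hH : ENNReal.ofReal ε ≤ Metric.ediam K → σ ^ 2 * logCard (locPacking cs K (c * ε)) ≤ B) :
    worstCaseRisk K σ (lse K) ≤ ENNReal.ofReal (ε ^ 2 + 96 * A ^ 2 * B) := by
  rcases le_total (Metric.ediam K) (ENNReal.ofReal ε) with hd | hd
  · refine (worstCaseRisk_lse_le_of_ediam hne hcl hK hd).trans (ENNReal.ofReal_le_ofReal ?_)
    exact le_add_of_nonneg_right (by positivity)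
  refine iSup₂_le fun μ hμ => (lintegral_lse_le hne hcl hK hμ hσ hε).trans ?_
  apply ENNReal.ofReal_le_ofReal
  have h0 : 0 ≤ logCard (locPacking cs K (c * ε)) := Real.log_natCast_nonneg _
  have hw : (localWidth K μ ε / ε) ^ 2 ≤ A ^ 2 * logCard (locPacking cs K (c * ε)) := by
    have h1 : 0 ≤ localWidth K μ ε / ε := div_nonneg (localWidth_nonneg hμ hε.le) hε.le
    calc _ ≤ (A * √(logCard (locPacking cs K (c * ε)))) ^ 2 := by
          gcongr
          exact hcond ε hε hd μ hμ
      _ = _ := by rw [mul_pow, Real.sq_sqrt h0]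
  refine add_le_add_right ?_ _
  calc 96 * σ ^ 2 * (localWidth K μ ε / ε) ^ 2
      ≤ 96 * σ ^ 2 * (A ^ 2 * logCard (locPacking cs K (c * ε))) := by gcongr
    _ = 96 * A ^ 2 * (σ ^ 2 * logCard (locPacking cs K (c * ε))) := by ring
    _ ≤ 96 * A ^ 2 * B := by
        gcongr
        exact hH hd

/-- The factor by which the least squares estimator may lose to the minimax risk. -/
def optimalityFactor (cs A c : ℝ) : ℝ := 8 * cs ^ 2 * (max 1 (1 / c) ^ 2 + 192 * A ^ 2)

theorem optimalityFactor_pos (hcs : 0 < cs) : 0 < optimalityFactor cs A c := by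
  have : 0 < max 1 (1 / c) := lt_max_of_lt_left one_pos
  rw [optimalityFactor]
  positivity

/-- The entropy lower bound is used in contrapositive form: below the diameter the condition `4 log
2` holds automatically, so a small minimax risk forces small local entropy. -/
theorem worstCaseRisk_lse_le_of_minimaxRisk_lt (hne : K.Nonempty) (hcl : IsClosed K)
    (hK : Convex ℝ K) (hcs : 16 < cs) (hc : 0 < c)
    (hcond : WidthEntropyCondition cs A c K) {σ ε : ℝ} (hσ : 0 < σ) (hε : 0 < ε)
    (hlt : minimaxRisk K σ < ENNReal.ofReal (ε ^ 2 / (8 * cs ^ 2))) :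
    worstCaseRisk K σ (lse K) ≤
      ENNReal.ofReal ((max 1 (1 / c) ^ 2 + 192 * A ^ 2) * ε ^ 2) := by
  set m := max 1 (1 / c) with hm
  have hm1 : 1 ≤ m := le_max_left _ _
  rcases le_or_gt (Metric.ediam K) (ENNReal.ofReal ε) with hd | hd
  · refine (worstCaseRisk_lse_le_of_ediam hne hcl hK hd).trans (ENNReal.ofReal_le_ofReal ?_)
    refine le_mul_of_one_le_left (by positivity) ?_
    nlinarith [sq_nonneg A]
  have hlog := four_mul_log_two_le hK hcs hε hd
  have hH : logCard (locPacking cs K ε) < 2 * (ε / σ) ^ 2 := by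
    by_contra! h
    exact hlt.not_ge (le_minimaxRisk hne (by linarith) hε hσ h hlog)
  -- The factor `m` raises the scale so that (1) evaluates the entropy at a radius no smaller than
  -- `ε`, where monotonicity applies.
  have hcm : ε ≤ c * (m * ε) := by
    have : 1 ≤ c * m := by
      calc (1 : ℝ) = c * (1 / c) := by field_simp
        _ ≤ c * m := by gcongr; exact le_max_right _ _
    nlinarith
  refine (worstCaseRisk_lse_le_of_logCard_le hne hcl hK hcond (ε := m * ε)
    (B := 2 * ε ^ 2) hσ (by positivity) (by positivity) fun _ => ?_).trans (le_of_eq ?_)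
  · calc σ ^ 2 * logCard (locPacking cs K (c * (m * ε)))
        ≤ σ ^ 2 * (2 * (ε / σ) ^ 2) := by
          gcongr
          exact (logCard_locPacking_anti hK (by linarith) hε hcm).trans hH.le
      _ = 2 * ε ^ 2 := by field_simp
  · congr 1
    ring

/-- Under the width-entropy condition the least squares estimator is minimax optimal. -/
theorem worstCaseRisk_lse_le_minimaxRisk (hne : K.Nonempty) (hcl : IsClosed K)
    (hK : Convex ℝ K) (hcs : 16 < cs) (hc : 0 < c)
    (hcond : WidthEntropyCondition cs A c K) {σ : ℝ} (hσ : 0 < σ) :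
    worstCaseRisk K σ (lse K) ≤
      ENNReal.ofReal (optimalityFactor cs A c) * minimaxRisk K σ := by
  have hcs0 : 0 < cs := by linarith
  have hF := optimalityFactor_pos (A := A) (c := c) hcs0
  rcases eq_or_ne (minimaxRisk K σ) ⊤ with htop | htop
  · rw [htop, ENNReal.mul_top (by simpa using hF)]
    exact le_top
  -- The slack makes the comparison with the minimax risk strict and the scale positive even if that
  -- risk is zero. Dividing it by the optimality factor makes the final excess exactly `δ`.
  refine ENNReal.le_of_forall_pos_le_add fun δ hδ _ => ?_
  set g := (minimaxRisk K σ).toReal with hg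
  have hgG : ENNReal.ofReal g = minimaxRisk K σ := ENNReal.ofReal_toReal htop
  have hg0 : 0 ≤ g := ENNReal.toReal_nonneg
  have hδ' : 0 < (δ : ℝ) / optimalityFactor cs A c := div_pos (by exact_mod_cast hδ) hF
  set g' := g + δ / optimalityFactor cs A c with hg'
  have hg'0 : 0 < g' := by linarith
  have hsq : √(8 * cs ^ 2 * g') ^ 2 = 8 * cs ^ 2 * g' := Real.sq_sqrt (by positivity)
  have h := worstCaseRisk_lse_le_of_minimaxRisk_lt hne hcl hK hcs hc hcond hσ
    (ε := √(8 * cs ^ 2 * g')) (by positivity) (by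
      rw [hsq, mul_div_cancel_left₀ _ (by positivity), ← hgG]
      exact (ENNReal.ofReal_lt_ofReal_iff hg'0).2 (by linarith))
  refine h.trans (le_of_eq ?_)
  rw [hsq, ← hgG, ← ENNReal.ofReal_mul hF.le, ← ENNReal.ofReal_coe_nnreal,
    ← ENNReal.ofReal_add (mul_nonneg hF.le hg0) δ.coe_nonneg]
  congr 1
  have : optimalityFactor cs A c * (δ / optimalityFactor cs A c) = δ := mul_div_cancel₀ _ hF.ne'
  rw [← this, hg', optimalityFactor]
  ring

theorem zero_mem_of_symmetric (hne : K.Nonempty) (hK : Convex ℝ K) (hsymm : ∀ x ∈ K, -x ∈ K) :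
    (0 : Rn n) ∈ K := by
  obtain ⟨x, hx⟩ := hne
  have := hK hx (hsymm x hx) (by norm_num : (0 : ℝ) ≤ 1 / 2) (by norm_num : (0 : ℝ) ≤ 1 / 2)
    (by norm_num)
  rwa [smul_neg, add_neg_cancel] at this

/-- The factor `2` in the width comparison cancels against halving the scale, so `A` is kept and
only `c` is halved. -/
theorem WidthEntropyConditionAtZero.widthEntropyCondition (hne : K.Nonempty) (hK : Convex ℝ K)
    (hsymm : ∀ x ∈ K, -x ∈ K) (hcs : 0 < cs) (hc : 0 < c) (hA : 0 ≤ A)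
    (h : WidthEntropyConditionAtZero cs A c K) : WidthEntropyCondition cs A (c / 2) K := by
  intro ε hε hd μ hμ
  have hε2 : 0 < ε / 2 := by positivity
  calc localWidth K μ ε / ε ≤ 2 * localWidth K 0 (ε / 2) / ε := by
        gcongr
        exact localWidth_le_two_mul_of_symmetric hK hsymm hε.le hμ
    _ = localWidth K 0 (ε / 2) / (ε / 2) := by field_simp
    _ ≤ A * √(logCard (ballPacking cs K 0 (c * (ε / 2)))) :=
        h _ hε2 ((ENNReal.ofReal_le_ofReal (by linarith)).trans hd)
    _ ≤ A * √(logCard (locPacking cs K (c / 2 * ε))) := by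
        rw [show c / 2 * ε = c * (ε / 2) by ring]
        gcongr
        exact logCard_mono (ballPacking_le_locPacking (zero_mem_of_symmetric hne hK hsymm))
          (locPacking_ne_top hcs (by positivity))

theorem WidthEntropyCondition.widthEntropyConditionAtZero (hne : K.Nonempty) (hK : Convex ℝ K)
    (hsymm : ∀ x ∈ K, -x ∈ K) (hcs : 0 < cs) (hc : 0 < c) (hA : 0 ≤ A)
    (h : WidthEntropyCondition cs A c K) : WidthEntropyConditionAtZero cs A (c / 2) K := by
  intro ε hε hd
  have h0 := zero_mem_of_symmetric hne hK hsymm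
  refine (h ε hε hd 0 h0).trans ?_
  gcongr
  rw [show c / 2 * ε = c * ε / 2 by ring]
  exact logCard_mono (locPacking_le_ballPacking_zero hK hsymm)
    (ne_top_of_le_ne_top (locPacking_ne_top hcs (by positivity)) (ballPacking_le_locPacking h0))

end Optimality

end GaussianSequence

end

theorem corollary2p7 :
    -- `cs` is the sufficiently large absolute constant of the local entropy
    ∃ c₀ : ℝ, 0 < c₀ ∧ ∀ cs : ℝ, c₀ ≤ cs → ∀ c : ℝ, 0 < c → ∀ A : ℝ, 0 < A →
      ∃ C : ℝ≥0, ∀ (n : ℕ) (K : Set (GaussianSequence.Rn n)),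
        K.Nonempty → IsClosed K → Convex ℝ K →
        (GaussianSequence.WidthEntropyCondition cs A c K →
          ∀ σ : ℝ, 0 < σ →
            GaussianSequence.worstCaseRisk K σ (GaussianSequence.lse K) ≤
              C * GaussianSequence.minimaxRisk K σ) ∧
        ((∀ x ∈ K, -x ∈ K) →
          (GaussianSequence.WidthEntropyConditionAtZero cs A c K →
            ∀ σ : ℝ, 0 < σ →
              GaussianSequence.worstCaseRisk K σ (GaussianSequence.lse K) ≤
                C * GaussianSequence.minimaxRisk K σ) ∧
          -- checking at `0` only loses nothing but a factor in `c`
          (GaussianSequence.WidthEntropyCondition cs A c K →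
            GaussianSequence.WidthEntropyConditionAtZero cs A (c / 2) K)) := by
  refine ⟨17, by norm_num, fun cs hcs c hc A hA => ?_⟩
  have hcs16 : 16 < cs := by linarith
  have hcs0 : 0 < cs := by linarith
  -- One constant serves both parts: the symmetric case reduces to the general one with `c / 2`.
  refine ⟨(max (GaussianSequence.optimalityFactor cs A c)
    (GaussianSequence.optimalityFactor cs A (c / 2))).toNNReal, fun n K hne hcl hK => ?_⟩
  refine ⟨fun h σ hσ => ?_, fun hsymm => ⟨fun h σ hσ => ?_, fun h => ?_⟩⟩
  · refine (GaussianSequence.worstCaseRisk_lse_le_minimaxRisk hne hcl hK hcs16 hc h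
      hσ).trans ?_
    gcongr
    exact ENNReal.ofReal_le_ofReal (le_max_left _ _)
  · refine (GaussianSequence.worstCaseRisk_lse_le_minimaxRisk hne hcl hK hcs16 (half_pos hc)
      (h.widthEntropyCondition hne hK hsymm hcs0 hc hA.le) hσ).trans ?_
    gcongr
    exact ENNReal.ofReal_le_ofReal (le_max_right _ _)
  · exact h.widthEntropyConditionAtZero hne hK hsymm hcs0 hc hA.le
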